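/- All sets are finite and all Hilbert spaces are finite-dimensional and nonzero. For a Hilbert space $\mathcal H$ let $L(\mathcal H)$ be the linear operators on $\mathcal H$; a density operator is a $\rho\ge 0$ in $L(\mathcal H)$ with $\operatorname{Tr}\rho=1$; a POVM with outcome set $\mathcal U$ is a family $(P^u)_{u\in\mathcal U}$ of positive semidefinite operators with $\sum_u P^u=\mathbb 1$; CPTP means completely positive, trace-preserving and linear. For a cq-state $\omega_{UA}=\sum_{u\in\mathcal U}q(u)|u\rangle\langle u|_U\otimes\omega^u_A$, with $q$ a probability distribution and each $\omega^u_A$ a density operator on $\mathcal H_A$, put $$P_{\rm guess}(U|A)_\omega=\max_{P}\sum_{u\in\mathcal U}q(u)\operatorname{Tr}[\omega^u_A\,P^u],$$ the maximum being over all POVMs $P=(P^u)_{u\in\mathcal U}$ on $\mathcal H_A$, and $$H_{\min}(U|A)_\omega=-\inf\{\lambda\in\mathbb R:\ \omega_{UA}\le 2^{\lambda}\,\mathbb 1_U\otimes\sigma_A\ \text{for some density operator }\sigma_A\text{ on }\mathcal H_A\}.$$ **Corollary.** Let $\mathcal N:L(\mathcal H_Q)\to L(\mathcal H_R)$ and $\mathcal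 N':L(\mathcal H_Q)\to L(\mathcal H_S)$ be two CPTP maps, and let $\mathcal H_{S'}$ be an auxiliary Hilbert space with $\mathcal H_{S'}\cong\mathcal H_S$. For a finite set $\mathcal U$, a probability distribution $q$ on $\mathcal U$ and density operators $\rho^u_{S'Q}$, $u\in\mathcal U$, on $\mathcal H_{S'}\otimes\mathcal H_Q$, let $$\sigma_{US'R}=\sum_{u}q(u)|u\rangle\langle u|_U\otimes(\mathsf{id}_{S'}\otimes\mathcal N)(\rho^u_{S'Q}),\qquad \tau_{US'S}=\sum_{u}q(u)|u\rangle\langle u|_U\otimes(\mathsf{id}_{S'}\otimes\mathcal N')(\rho^u_{S'Q}).$$ The following are equivalent: 1. $H_{\min}(U|S'R)_\sigma\le H_{\min}(U|S'S)_\tau$ for all such $\mathcal U$, $q$ and $(\rho^u_{S'Q})_{u\in\mathcal U}$; 2. $P_{\rm guess}(U|S'R)_\sigma\ge P_{\rm guess}(U|S'S)_\tau$ for all such $\mathcal U$, $q$ and $(\rho^u_{S'Q})_{u\in\mathcal U}$; 3. $\mathcal N$ is degradable into $\mathcal N'$: there is a CPTP map $\mathcal T:L(\mathcal H_R)\to L(\mathcal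 H_S)$ with $\mathcal N'=\mathcal T\circ\mathcal N$. -/

import Mathlib

open scoped Kronecker ComplexOrder

/-! Finite-dimensional Hilbert spaces are taken in coordinates: a finite type `q` stands for an
orthonormal basis of `ℋ_Q`, the operators `L(ℋ_Q)` are `Matrix q q ℂ`, and `ℋ_A ⊗ ℋ_B` has the
basis `a × b`. -/

namespace QuantumComparison

/-- Density operators: positive semidefinite with unit trace. -/
def IsDensity {q : Type*} [Fintype q] (ρ : Matrix q q ℂ) : Prop :=
  ρ.PosSemidef ∧ ρ.trace = 1

/-- Positive-operator valued measures with finite outcome set `u`. -/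
def IsPOVM {u q : Type*} [Fintype u] [Fintype q] [DecidableEq q] (P : u → Matrix q q ℂ) : Prop :=
  (∀ x, (P x).PosSemidef) ∧ ∑ x, P x = 1

/-- Probability distributions on a finite set. -/
def IsProbDist {u : Type*} [Fintype u] (p : u → ℝ) : Prop :=
  (∀ x, 0 ≤ p x) ∧ ∑ x, p x = 1

/-- The map `id_A ⊗ N : L(ℋ_A ⊗ ℋ_Q) → L(ℋ_A ⊗ ℋ_R)`: it applies `N` to each of the `a × a` blocks
of a matrix on `ℋ_A ⊗ ℋ_Q`. -/
def idTensor (a : Type*) {q r : Type*} (N : Matrix q q ℂ →ₗ[ℂ] Matrix r r ℂ) :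
    Matrix (a × q) (a × q) ℂ →ₗ[ℂ] Matrix (a × r) (a × r) ℂ where
  toFun M := Matrix.of fun x y => N (Matrix.of fun i j => M (x.1, i) (y.1, j)) x.2 y.2
  map_add' M M' := by
    ext x y
    exact congrFun (congrFun (N.map_add (Matrix.of fun i j => M (x.1, i) (y.1, j))
      (Matrix.of fun i j => M' (x.1, i) (y.1, j))) x.2) y.2
  map_smul' c M := by
    ext x y
    exact congrFun (congrFun (N.map_smul c (Matrix.of fun i j => M (x.1, i) (y.1, j))) x.2) y.2

/-- `idTensor` is characterized by its action on product operators. -/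
theorem idTensor_kronecker {a q r : Type*} (N : Matrix q q ℂ →ₗ[ℂ] Matrix r r ℂ)
    (A : Matrix a a ℂ) (X : Matrix q q ℂ) : idTensor a N (A ⊗ₖ X) = A ⊗ₖ N X := by
  ext x y
  exact congrFun (congrFun (N.map_smul (A x.1 y.1) X) x.2) y.2

/-- Complete positivity: `id_k ⊗ N` is positive for every `k`. -/
def IsCompletelyPositive {q r : Type*} [Fintype q] [Fintype r]
    (N : Matrix q q ℂ →ₗ[ℂ] Matrix r r ℂ) : Prop :=
  ∀ (k : ℕ) (M : Matrix (Fin k × q) (Fin k × q) ℂ),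
    M.PosSemidef → (idTensor (Fin k) N M).PosSemidef

/-- Completely positive trace-preserving linear maps, i.e. quantum channels. -/
def IsCPTP {q r : Type*} [Fintype q] [Fintype r]
    (N : Matrix q q ℂ →ₗ[ℂ] Matrix r r ℂ) : Prop :=
  IsCompletelyPositive N ∧ ∀ X, (N X).trace = X.trace

/-- `N` is degradable into `N'`. -/
def IsDegradableInto {q r s : Type*} [Fintype r] [Fintype s]
    (N : Matrix q q ℂ →ₗ[ℂ] Matrix r r ℂ) (N' : Matrix q q ℂ →ₗ[ℂ] Matrix s s ℂ) : Prop :=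
  ∃ T : Matrix r r ℂ →ₗ[ℂ] Matrix s s ℂ, IsCPTP T ∧ N' = T ∘ₗ N

/-- The classical-quantum state `∑ₓ p(x) |x⟩⟨x| ⊗ ρˣ`. -/
noncomputable def cqState {u q : Type*} [Fintype u] [DecidableEq u] (p : u → ℝ)
    (ρ : u → Matrix q q ℂ) : Matrix (u × q) (u × q) ℂ :=
  ∑ x, (p x : ℂ) • (Matrix.single x x (1 : ℂ) ⊗ₖ ρ x)

/-- The guessing probability `P_guess(X|Q) = max_P ∑ₓ p(x) Tr[ρˣ Pˣ]` of the ensemble `(p, ρ)`, the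
maximum being over all POVMs on `ℋ_Q` with outcomes in the range of `X`. -/
noncomputable def pGuess {u q : Type*} [Fintype u] [Fintype q] [DecidableEq q] (p : u → ℝ)
    (ρ : u → Matrix q q ℂ) : ℝ :=
  sSup {g : ℝ | ∃ P : u → Matrix q q ℂ, IsPOVM P ∧ g = ∑ x, p x * ((ρ x * P x).trace).re}

/-- The conditional min-entropy `H_min(A|Q)` of a bipartite state `ρ` on `ℋ_A ⊗ ℋ_Q`:
minus the infimum of all `t` such that `ρ ≤ 2ᵗ 1 ⊗ σ` for some density operator `σ` on `ℋ_Q`. -/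
noncomputable def condMinEntropy {a q : Type*} [Fintype a] [DecidableEq a] [Fintype q]
    (ρ : Matrix (a × q) (a × q) ℂ) : ℝ :=
  -sInf {t : ℝ | ∃ σ : Matrix q q ℂ, IsDensity σ ∧
    ((((2 : ℝ) ^ t : ℝ) : ℂ) • ((1 : Matrix a a ℂ) ⊗ₖ σ) - ρ).PosSemidef}

end QuantumComparison

/-! For cq-states, semidefinite duality gives `H_min = -log₂ P_guess`: the scores of POVMs are
bounded by the trace of any common upper bound of the weighted states (`score_le_rpow`), and the
bound is attained (`exists_common_upper_bound`). This makes 1 and 2 equivalent. It also gives 3 → 2: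
applying `id ⊗ T` to an optimal upper bound yields an upper bound for the degraded states
(`IsCPTP.pGuess_idTensor_le`).

For 2 → 3, suppose `N'` is no `T ∘ N`. The Choi matrices of the maps `T ∘ N` form a compact convex
set, so Hahn–Banach separates that of `N'` from it. The separating functional, realigned as an
operator on `S'Q`, shifted by a multiple of the identity and normalized, becomes a state `ρ` whose
overlap with the maximally entangled state is larger after `N'` than after every `T ∘ N`
(`exists_density_overlap_lt`). The game: `S'` is rotated by one of `d²` Heisenberg–Weyl unitaries,
chosen uniformly, and the rotation is to be guessed. After `N'`, the Bell measurement scores `1/d`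
times the overlap. After `N`, any POVM, with its rotations undone and summed, is up to scale the
Choi matrix of a channel `T`, so it scores `1/d` times the overlap for `T ∘ N`
(`exists_channelChoi_overlap`), which is smaller. -/

open scoped Kronecker ComplexOrder

namespace QuantumComparison

/-! ### Positive semidefinite matrices -/

section Matrices

variable {n k : Type*} [Fintype n] [Fintype k]

open scoped Matrix.Norms.L2Operator MatrixOrder in
theorem exists_eq_conjTranspose_mul_self {A : Matrix n n ℂ} (hA : A.PosSemidef) :
    ∃ C : Matrix n n ℂ, A = C.conjTranspose * C := by
  classical
  exact CStarAlgebra.nonneg_iff_eq_star_mul_self.1 hA.nonneg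

theorem posSemidef_real_smul {n : Type*} {A : Matrix n n ℂ} (hA : A.PosSemidef) {c : ℝ}
    (hc : 0 ≤ c) :
    ((c : ℂ) • A).PosSemidef :=
  hA.smul (Complex.zero_le_real.2 hc)

theorem trace_mul_nonneg {A B : Matrix n n ℂ} (hA : A.PosSemidef) (hB : B.PosSemidef) :
    0 ≤ (A * B).trace := by
  obtain ⟨C, rfl⟩ := exists_eq_conjTranspose_mul_self hB
  rw [← Matrix.mul_assoc, Matrix.trace_mul_comm, ← Matrix.mul_assoc]
  exact (hA.mul_mul_conjTranspose_same C).trace_nonneg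

theorem re_trace_mul_nonneg {A B : Matrix n n ℂ} (hA : A.PosSemidef) (hB : B.PosSemidef) :
    0 ≤ (A * B).trace.re :=
  (Complex.le_def.1 (trace_mul_nonneg hA hB)).1

/-- Every real linear functional on complex matrices has the form `A ↦ Re Tr[K A]`. -/
theorem exists_re_trace_repr [DecidableEq n] (f : Matrix n n ℂ →ₗ[ℝ] ℝ) :
    ∃ K : Matrix n n ℂ, ∀ A, f A = (K * A).trace.re := by
  -- Chosen so that `Re (K j i * z) = Re z * f (E i j) + Im z * f (i E i j)`, with `E i j` the
  -- matrix units.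
  refine ⟨Matrix.of fun j i => (f (Matrix.single i j 1) : ℂ) -
    (f (Matrix.single i j Complex.I) : ℂ) * Complex.I, fun A => ?_⟩
  have hdec : ∀ i j, f (Matrix.single i j (A i j)) =
      (A i j).re * f (Matrix.single i j 1) + (A i j).im * f (Matrix.single i j Complex.I) := by
    intro i j
    have : Matrix.single i j (A i j) = (A i j).re • Matrix.single i j (1 : ℂ) +
        (A i j).im • Matrix.single i j Complex.I := by
      rw [Matrix.smul_single, Matrix.smul_single, ← Matrix.single_add]
      congr 1
      simp
    rw [this, map_add, map_smul, map_smul, smul_eq_mul, smul_eq_mul]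
  conv_lhs => rw [Matrix.matrix_eq_sum_single A]
  simp only [map_sum, hdec, Matrix.trace, Matrix.diag, Matrix.mul_apply, Complex.re_sum,
    Matrix.of_apply]
  rw [Finset.sum_comm]
  refine Finset.sum_congr rfl fun j _ => Finset.sum_congr rfl fun i _ => ?_
  simp
  ring

theorem re_trace_conjTranspose_mul {A : Matrix n n ℂ} (hA : A.IsHermitian) (K : Matrix n n ℂ) :
    (K.conjTranspose * A).trace.re = (K * A).trace.re := by
  have : K.conjTranspose * A = (A * K).conjTranspose := by
    rw [Matrix.conjTranspose_mul, hA.eq]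
  rw [this, Matrix.trace_conjTranspose, Matrix.trace_mul_comm]
  simp

/-- On Hermitian matrices a real linear functional is represented by a Hermitian matrix. -/
theorem exists_isHermitian_re_trace_repr [DecidableEq n] (f : Matrix n n ℂ →ₗ[ℝ] ℝ) :
    ∃ K : Matrix n n ℂ, K.IsHermitian ∧
      ∀ A : Matrix n n ℂ, A.IsHermitian → f A = (K * A).trace.re := by
  obtain ⟨K, hK⟩ := exists_re_trace_repr f
  refine ⟨(1 / 2 : ℝ) • (K + K.conjTranspose), ?_, fun A hA => ?_⟩
  · exact (IsSelfAdjoint.all (1 / 2 : ℝ)).smul (Matrix.isHermitian_add_transpose_self K)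
  · rw [hK, Matrix.smul_mul, Matrix.trace_smul, Complex.smul_re, Matrix.add_mul,
      Matrix.trace_add, Complex.add_re, re_trace_conjTranspose_mul hA, smul_eq_mul]
    ring

open scoped Matrix.Norms.L2Operator MatrixOrder in
theorem exists_posSemidef_smul_one_add [DecidableEq n] {A : Matrix n n ℂ} (hA : A.IsHermitian) :
    ∃ c : ℝ, 0 ≤ c ∧ ((c : ℂ) • (1 : Matrix n n ℂ) + A).PosSemidef := by
  refine ⟨‖A‖, norm_nonneg _, ?_⟩
  have h := IsSelfAdjoint.neg_algebraMap_norm_le_self (a := A) hA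
  rw [Matrix.le_iff, sub_neg_eq_add, Algebra.algebraMap_eq_smul_one, add_comm] at h
  exact h

/-- Self-duality of the positive semidefinite cone; rank-one test operators suffice. -/
theorem posSemidef_of_re_trace_nonneg {A : Matrix n n ℂ} (hA : A.IsHermitian)
    (h : ∀ B : Matrix n n ℂ, B.PosSemidef → 0 ≤ (A * B).trace.re) : A.PosSemidef := by
  refine Matrix.PosSemidef.of_dotProduct_mulVec_nonneg hA fun v => ?_
  have h1 := h _ (Matrix.posSemidef_vecMulVec_self_star v)
  rw [Matrix.mul_vecMulVec, Matrix.trace_vecMulVec, dotProduct_comm] at h1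
  have h2 := hA.im_star_dotProduct_mulVec_self v
  exact Complex.le_def.2 ⟨h1, by simpa using h2.symm⟩

theorem norm_apply_le_re_trace {A : Matrix n n ℂ} (hA : A.PosSemidef) (i j : n) :
    ‖A i j‖ ≤ A.trace.re := by
  obtain ⟨C, rfl⟩ := exists_eq_conjTranspose_mul_self hA
  have hdiag : ∀ i, ((C.conjTranspose * C) i i).re = ∑ x, ‖C x i‖ ^ 2 := by
    intro i
    rw [Matrix.mul_apply, Complex.re_sum]
    refine Finset.sum_congr rfl fun x _ => ?_
    rw [Matrix.conjTranspose_apply, ← Complex.normSq_eq_norm_sq, Complex.star_def,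
      Complex.normSq_eq_conj_mul_self.symm, Complex.ofReal_re]
  have hle : ∀ i, ∑ x, ‖C x i‖ ^ 2 ≤ (C.conjTranspose * C).trace.re := by
    intro i
    rw [Matrix.trace, Complex.re_sum]
    simp only [Matrix.diag, hdiag]
    exact Finset.single_le_sum (f := fun i => ∑ x, ‖C x i‖ ^ 2)
      (fun i _ => Finset.sum_nonneg fun x _ => sq_nonneg _) (Finset.mem_univ i)
  calc ‖(C.conjTranspose * C) i j‖ ≤ ∑ x, ‖C.conjTranspose i x * C x j‖ := by
        rw [Matrix.mul_apply]; exact norm_sum_le _ _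
    _ ≤ ∑ x, (‖C x i‖ ^ 2 + ‖C x j‖ ^ 2) / 2 := by
        refine Finset.sum_le_sum fun x _ => ?_
        rw [norm_mul, Matrix.conjTranspose_apply, norm_star]
        nlinarith [sq_nonneg (‖C x i‖ - ‖C x j‖)]
    _ ≤ (C.conjTranspose * C).trace.re := by
        rw [← Finset.sum_div, Finset.sum_add_distrib]
        linarith [hle i, hle j]

/-- Summing out an index pair of a positive semidefinite matrix. -/
theorem posSemidef_sum_blocks {A : Matrix (n × k) (n × k) ℂ} (hA : A.PosSemidef) :
    (Matrix.of fun x y => ∑ i, ∑ j, A (x, i) (y, j) : Matrix n n ℂ).PosSemidef := by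
  classical
  -- The sum is the compression of `A` by `1 ⊗` (all-ones column).
  convert hA.conjTranspose_mul_mul_same
    (Matrix.of fun x y => if x.1 = y then 1 else 0 : Matrix (n × k) n ℂ) using 1
  ext x y
  simp only [Matrix.of_apply, Matrix.mul_apply, Matrix.conjTranspose_apply,
    Fintype.sum_prod_type, Finset.sum_mul]
  simp [apply_ite star]
  exact Finset.sum_comm

theorem isClosed_posSemidef : IsClosed {A : Matrix n n ℂ | A.PosSemidef} := by
  simp only [Matrix.posSemidef_iff_dotProduct_mulVec, Set.ofPred_and, Set.ofPred_forall]
  refine IsClosed.inter ?_ (isClosed_iInter fun x => ?_)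
  · exact isClosed_eq (by fun_prop) continuous_id
  · exact isClosed_le continuous_const (by fun_prop)

end Matrices

/-! ### Guessing probability and min-entropy -/

section Duality

variable {u n : Type*} [Fintype u] [Fintype n] [DecidableEq n]

/-- Strong duality for the guessing problem of a family of Hermitian operators: an upper bound on
all scores is attained as the trace of a common upper bound of the family. -/
theorem exists_common_upper_bound [Nonempty u] [Nonempty n] {w : u → Matrix n n ℂ}
    (hw : ∀ x, (w x).IsHermitian) {g : ℝ}
    (hg : ∀ P : u → Matrix n n ℂ, IsPOVM P → ∑ x, (w x * P x).trace.re ≤ g) :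
    ∃ K : Matrix n n ℂ, K.IsHermitian ∧ K.trace.re = g ∧ ∀ x, (K - w x).PosSemidef := by
  classical
  -- Pairs `(A, t)` such that some positive family with total `A + A*` scores at least `t`. Using `A
  -- + A*` admits non-Hermitian `A`, so the cone and the subspace `D` below together span the whole
  -- space, as M. Riesz extension requires; the price is the factors of 2.
  let s : PointedCone ℝ (Matrix n n ℂ × ℝ) :=
    { carrier := {y | ∃ P : u → Matrix n n ℂ, (∀ x, (P x).PosSemidef) ∧
        ∑ x, P x = y.1 + y.1.conjTranspose ∧ y.2 ≤ ∑ x, (w x * P x).trace.re}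
      add_mem' := by
        rintro a b ⟨P, hP, hPs, hPt⟩ ⟨Q, hQ, hQs, hQt⟩
        refine ⟨fun x => P x + Q x, fun x => (hP x).add (hQ x), ?_, ?_⟩
        · rw [Finset.sum_add_distrib, hPs, hQs, Prod.fst_add, Matrix.conjTranspose_add]
          abel
        · simp only [Matrix.mul_add, Matrix.trace_add, Complex.add_re, Finset.sum_add_distrib,
            Prod.snd_add]
          linarith
      zero_mem' := ⟨fun _ => 0, fun _ => .zero, by simp, by simp⟩
      smul_mem' := by
        rintro c a ⟨P, hP, hPs, hPt⟩
        refine ⟨fun x => ((c : ℝ) : ℂ) • P x, fun x => posSemidef_real_smul (hP x) c.2, ?_, ?_⟩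
        · have hca : (c • a).1 = ((c : ℝ) : ℂ) • a.1 := by
            ext i j
            exact Complex.real_smul
          rw [← Finset.smul_sum, hPs, smul_add, hca, Matrix.conjTranspose_smul, Complex.star_def,
            Complex.conj_ofReal]
        · simp only [Matrix.mul_smul, Matrix.trace_smul, smul_eq_mul, Complex.re_ofReal_mul,
            ← Finset.mul_sum]
          exact mul_le_mul_of_nonneg_left hPt c.2 }
  have hcard : (0 : ℝ) < Fintype.card n := by exact_mod_cast Fintype.card_pos
  -- Nonnegativity of `(a • 1, t) ↦ 2ag - t` on the cone is the hypothesis `hg` rescaled to families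
  -- with total `2a • 1`.
  let L : Matrix n n ℂ × ℝ →ₗ[ℝ] ℝ :=
    (2 * g / Fintype.card n) • (Complex.reLm ∘ₗ (Matrix.traceLinearMap n ℝ ℂ) ∘ₗ
      LinearMap.fst ℝ _ _) - LinearMap.snd ℝ _ _
  have hL : ∀ (a t : ℝ), L (a • 1, t) = 2 * a * g - t := by
    intro a t
    simp [L]
    field_simp
  let D : Submodule ℝ (Matrix n n ℂ × ℝ) :=
    (Submodule.span ℝ {(1 : Matrix n n ℂ)}).prod ⊤
  obtain ⟨f, hfD, hfs⟩ := riesz_extension s ⟨D, L ∘ₗ D.subtype⟩ (by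
    rintro ⟨⟨A, t⟩, hA, _⟩ ⟨P, hP, hPs, hPt⟩
    obtain ⟨a, rfl⟩ := Submodule.mem_span_singleton.1 hA
    change 0 ≤ L (a • 1, t)
    rw [hL]
    simp only at hPs hPt
    have hsum : ∑ x, P x = ((2 * a : ℝ) : ℂ) • (1 : Matrix n n ℂ) := by
      rw [hPs, Matrix.conjTranspose_smul, Matrix.conjTranspose_one, ← add_smul, star_trivial,
        ← two_mul]
      ext i j
      simp [Matrix.smul_apply]
    have htr : ∑ x, (P x).trace = ((2 * a * Fintype.card n : ℝ) : ℂ) := by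
      rw [← Matrix.trace_sum, hsum, Matrix.trace_smul, Matrix.trace_one]
      simp
    have hnn : ∀ x, 0 ≤ (P x).trace := fun x => (hP x).trace_nonneg
    have ha : 0 ≤ 2 * a := by
      have : (0 : ℂ) ≤ ((2 * a * Fintype.card n : ℝ) : ℂ) :=
        htr ▸ Finset.sum_nonneg fun x _ => hnn x
      exact nonneg_of_mul_nonneg_left (Complex.zero_le_real.1 this) hcard
    rcases ha.eq_or_lt with h0 | hpos
    -- Rescaling is impossible at total zero, but there the family itself vanishes.
    · have hz : ∀ x, P x = 0 := by
        intro x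
        rw [← h0, zero_mul, Complex.ofReal_zero,
          Finset.sum_eq_zero_iff_of_nonneg fun x _ => hnn x] at htr
        exact (hP x).trace_eq_zero_iff.1 (htr x (Finset.mem_univ x))
      simp only [hz, Matrix.mul_zero, Matrix.trace_zero, Complex.zero_re,
        Finset.sum_const_zero] at hPt
      rw [← h0]
      linarith
    · have := hg (fun x => (((2 * a)⁻¹ : ℝ) : ℂ) • P x)
        ⟨fun x => posSemidef_real_smul (hP x) (inv_nonneg.2 ha), by
          rw [← Finset.smul_sum, hsum, smul_smul, ← Complex.ofReal_mul,
            inv_mul_cancel₀ hpos.ne', Complex.ofReal_one, one_smul]⟩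
      simp only [Matrix.mul_smul, Matrix.trace_smul, smul_eq_mul, Complex.re_ofReal_mul,
        ← Finset.mul_sum] at this
      rw [inv_mul_le_iff₀ hpos] at this
      linarith) (by
    rintro ⟨A, t⟩
    obtain ⟨c, hc, hcA⟩ := exists_posSemidef_smul_one_add
      (Matrix.isHermitian_add_transpose_self A)
    obtain ⟨x₀⟩ := ‹Nonempty u›
    -- A large multiple of the identity makes the total positive; all of it goes to one outcome, and
    -- the free second coordinate absorbs the score.
    let P : u → Matrix n n ℂ := Pi.single x₀ ((c : ℂ) • 1 + (A + A.conjTranspose))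
    refine ⟨⟨((c / 2) • 1, ∑ x, (w x * P x).trace.re - t),
      Submodule.mem_span_singleton.2 ⟨c / 2, rfl⟩, trivial⟩, P, fun x => ?_, ?_, ?_⟩
    · by_cases h : x = x₀
      · subst h; simpa [P] using hcA
      · simpa [P, h] using Matrix.PosSemidef.zero
    · simp only [P, Finset.sum_pi_single', Finset.mem_univ, if_true, Prod.mk_add_mk]
      rw [Matrix.conjTranspose_add, Matrix.conjTranspose_smul, Matrix.conjTranspose_one,
        star_trivial, add_add_add_comm, ← add_smul, add_halves]
      rfl
    · simp)
  have hf1 : f (1, 0) = 2 * g := by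
    have := hfD ⟨(1, 0), Submodule.mem_span_singleton_self _, trivial⟩
    rw [this]
    have := hL 1 0
    simpa using this
  have hf2 : ∀ t : ℝ, f (0, t) = -t := by
    intro t
    have := hfD ⟨(0, t), zero_mem _, trivial⟩
    rw [this]
    have := hL 0 t
    simpa using this
  obtain ⟨K, hK, hKf⟩ := exists_isHermitian_re_trace_repr (f ∘ₗ LinearMap.inl ℝ _ ℝ)
  -- Putting `B + B` on outcome `x` shows `Tr[K B] ≥ 2 Tr[w x B]` for all positive `B`, hence `K / 2
  -- ≥ w x`.
  refine ⟨(1 / 2 : ℝ) • K, (IsSelfAdjoint.all (1 / 2 : ℝ)).smul hK, ?_, fun x => ?_⟩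
  · have := hKf 1 Matrix.isHermitian_one
    simp only [LinearMap.comp_apply, LinearMap.inl_apply, hf1, Matrix.mul_one] at this
    rw [Matrix.trace_smul, Complex.smul_re, smul_eq_mul, ← this]
    ring
  · refine posSemidef_of_re_trace_nonneg
      (((IsSelfAdjoint.all (1 / 2 : ℝ)).smul hK).sub (hw x)) fun B hB => ?_
    have hmem : (B, ∑ y, (w y * (Pi.single x (B + B) : u → Matrix n n ℂ) y).trace.re) ∈ s := by
      refine ⟨Pi.single x (B + B), fun y => ?_, ?_, le_rfl⟩
      · by_cases h : y = x
        · subst h; simpa using hB.add hB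
        · simpa [h] using Matrix.PosSemidef.zero
      · simp [hB.isHermitian.eq]
    have hsum : ∑ y, (w y * (Pi.single x (B + B) : u → Matrix n n ℂ) y).trace.re =
        2 * (w x * B).trace.re := by
      rw [Finset.sum_eq_single x (fun y _ h => by simp [h]) (by simp)]
      simp [Matrix.mul_add]
      ring
    have h := hfs _ hmem
    rw [hsum] at h
    have hsplit : f (B, 2 * (w x * B).trace.re) = f (B, 0) + f (0, 2 * (w x * B).trace.re) := by
      rw [← map_add]; simp
    have hB' := hKf B hB.isHermitian
    simp only [LinearMap.comp_apply, LinearMap.inl_apply] at hB'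
    rw [hsplit, hf2, hB'] at h
    rw [Matrix.sub_mul, Matrix.smul_mul, Matrix.trace_sub, Matrix.trace_smul, Complex.sub_re,
      Complex.smul_re, smul_eq_mul]
    linarith

end Duality

/-! ### Min-entropy of cq-states through the guessing probability. -/

section Entropy

variable {u n : Type*} [Fintype u] [Fintype n]

theorem IsProbDist.nonempty {p : u → ℝ} (hp : IsProbDist p) : Nonempty u := by
  by_contra h
  rw [not_nonempty_iff] at h
  simpa using hp.2

theorem IsDensity.nonempty {ρ : Matrix n n ℂ} (hρ : IsDensity ρ) : Nonempty n := by
  by_contra h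
  rw [not_nonempty_iff] at h
  simpa [Matrix.trace] using hρ.2

theorem isDensity_inv_trace_smul {A : Matrix n n ℂ} (hA : A.PosSemidef) (h : 0 < A.trace.re) :
    IsDensity (((A.trace.re⁻¹ : ℝ) : ℂ) • A) := by
  refine ⟨posSemidef_real_smul hA (inv_nonneg.2 h.le), ?_⟩
  have : A.trace = (A.trace.re : ℂ) :=
    Complex.ext rfl (by simpa using (Complex.le_def.1 hA.trace_nonneg).2.symm)
  rw [Matrix.trace_smul, this, smul_eq_mul, Complex.ofReal_re, ← Complex.ofReal_mul,
    inv_mul_cancel₀ h.ne', Complex.ofReal_one]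

/-- A cq-state is dominated by `c 1 ⊗ σ` iff all its components are dominated by `c σ`. -/
theorem posSemidef_smul_one_kronecker_sub_cqState_iff [DecidableEq u] {p : u → ℝ}
    {ρ : u → Matrix n n ℂ} {c : ℂ} {σ : Matrix n n ℂ} :
    (c • ((1 : Matrix u u ℂ) ⊗ₖ σ) - cqState p ρ).PosSemidef ↔
      ∀ x, (c • σ - (p x : ℂ) • ρ x).PosSemidef := by
  have hsum : c • ((1 : Matrix u u ℂ) ⊗ₖ σ) - cqState p ρ =
      ∑ x, Matrix.single x x (1 : ℂ) ⊗ₖ (c • σ - (p x : ℂ) • ρ x) := by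
    have hone : (1 : Matrix u u ℂ) = ∑ x, Matrix.single x x (1 : ℂ) := by
      ext i j
      simp [Matrix.sum_apply, Matrix.single_apply, Matrix.one_apply, ite_and]
    ext ⟨i, k⟩ ⟨j, l⟩
    simp [hone, cqState, Matrix.sum_apply, Matrix.kroneckerMap_apply, Finset.mul_sum,
      Finset.sum_mul, ← Finset.sum_sub_distrib]
    refine Finset.sum_congr rfl fun x _ => ?_
    ring
  rw [hsum]
  constructor
  · intro h x
    convert h.submatrix (fun i => (x, i)) using 1
    ext i j
    simp [Matrix.sum_apply, Matrix.kroneckerMap_apply, Matrix.single_apply]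
  · intro h
    refine Matrix.posSemidef_sum _ fun x _ => Matrix.PosSemidef.kronecker ?_ (h x)
    rw [← Matrix.diagonal_single]
    exact Matrix.PosSemidef.diagonal (Pi.single_nonneg.2 zero_le_one)

/-- The exponents over which the infimum in the min-entropy of a cq-state is taken. -/
def minEntropyExponents (p : u → ℝ) (ρ : u → Matrix n n ℂ) : Set ℝ :=
  {t | ∃ σ : Matrix n n ℂ, IsDensity σ ∧
    ∀ x, ((((2 : ℝ) ^ t : ℝ) : ℂ) • σ - (p x : ℂ) • ρ x).PosSemidef}

theorem condMinEntropy_cqState [DecidableEq u] (p : u → ℝ) (ρ : u → Matrix n n ℂ) :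
    condMinEntropy (cqState p ρ) = -sInf (minEntropyExponents p ρ) := by
  simp only [condMinEntropy, posSemidef_smul_one_kronecker_sub_cqState_iff, minEntropyExponents]

variable {p : u → ℝ} {ρ : u → Matrix n n ℂ}

/-- The average state dominates each weighted component, so exponent 0 is admissible. By weak
duality this bounds the scores, which makes the supremum in `pGuess` meaningful. -/
theorem minEntropyExponents_nonempty (hp : IsProbDist p) (hρ : ∀ x, IsDensity (ρ x)) :
    (minEntropyExponents p ρ).Nonempty := by
  obtain ⟨x₀⟩ := hp.nonempty
  have := (hρ x₀).nonempty
  have hpos : ∀ x, ((p x : ℂ) • ρ x).PosSemidef := fun x => posSemidef_real_smul (hρ x).1 (hp.1 x)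
  have hsum : (∑ x, (p x : ℂ) • ρ x).PosSemidef := Matrix.posSemidef_sum _ fun x _ => hpos x
  have htr : (∑ x, (p x : ℂ) • ρ x).trace = 1 := by
    rw [Matrix.trace_sum]
    simp only [Matrix.trace_smul, (hρ _).2, smul_eq_mul, mul_one]
    exact_mod_cast hp.2
  classical
  refine ⟨0, ∑ x, (p x : ℂ) • ρ x, ⟨hsum, htr⟩, fun x => ?_⟩
  rw [Real.rpow_zero, Complex.ofReal_one, one_smul,
    ← Finset.add_sum_erase _ _ (Finset.mem_univ x), add_sub_cancel_left]
  exact Matrix.posSemidef_sum _ fun y _ => hpos y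

variable [DecidableEq n]

/-- Weak duality. -/
theorem score_le_rpow {t : ℝ} (ht : t ∈ minEntropyExponents p ρ) {P : u → Matrix n n ℂ}
    (hP : IsPOVM P) : ∑ x, p x * (ρ x * P x).trace.re ≤ 2 ^ t := by
  obtain ⟨σ, hσ, hdom⟩ := ht
  have h1 : ∀ x, p x * (ρ x * P x).trace.re ≤ 2 ^ t * (σ * P x).trace.re := by
    intro x
    have := re_trace_mul_nonneg (hdom x) (hP.1 x)
    rw [Matrix.sub_mul, Matrix.smul_mul, Matrix.smul_mul, Matrix.trace_sub, Matrix.trace_smul,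
      Matrix.trace_smul, Complex.sub_re, smul_eq_mul, smul_eq_mul, Complex.re_ofReal_mul,
      Complex.re_ofReal_mul] at this
    linarith
  calc _ ≤ ∑ x, 2 ^ t * (σ * P x).trace.re := Finset.sum_le_sum fun x _ => h1 x
    _ = 2 ^ t * (σ * ∑ x, P x).trace.re := by
        rw [Matrix.mul_sum, Matrix.trace_sum, Complex.re_sum, Finset.mul_sum]
    _ = 2 ^ t := by rw [hP.2, Matrix.mul_one, hσ.2, Complex.one_re, mul_one]

theorem exists_isPOVM [Nonempty u] : ∃ P : u → Matrix n n ℂ, IsPOVM P := by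
  classical
  obtain ⟨x₀⟩ := ‹Nonempty u›
  refine ⟨Pi.single x₀ 1, fun x => ?_, by simp⟩
  by_cases h : x = x₀
  · subst h; simpa using Matrix.PosSemidef.one
  · simpa [h] using Matrix.PosSemidef.zero

theorem pGuess_le_rpow [Nonempty u] {t : ℝ} (ht : t ∈ minEntropyExponents p ρ) :
    pGuess p ρ ≤ 2 ^ t := by
  obtain ⟨P, hP⟩ := exists_isPOVM (u := u) (n := n)
  refine csSup_le ⟨_, P, hP, rfl⟩ ?_
  rintro _ ⟨P, hP, rfl⟩
  exact score_le_rpow ht hP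

theorem score_le_pGuess (hp : IsProbDist p) (hρ : ∀ x, IsDensity (ρ x)) {P : u → Matrix n n ℂ}
    (hP : IsPOVM P) : ∑ x, p x * (ρ x * P x).trace.re ≤ pGuess p ρ := by
  obtain ⟨t, ht⟩ := minEntropyExponents_nonempty hp hρ
  refine le_csSup ⟨2 ^ t, ?_⟩ ⟨P, hP, rfl⟩
  rintro _ ⟨P, hP, rfl⟩
  exact score_le_rpow ht hP

/-- Uniform random guessing scores `1 / |U|`. Positivity is what allows taking logarithms. -/
theorem pGuess_pos (hp : IsProbDist p) (hρ : ∀ x, IsDensity (ρ x)) : 0 < pGuess p ρ := by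
  have := hp.nonempty
  have hc : (0 : ℝ) < Fintype.card u := by exact_mod_cast Fintype.card_pos
  have hP : IsPOVM fun _ : u => (((Fintype.card u : ℝ)⁻¹ : ℝ) : ℂ) • (1 : Matrix n n ℂ) := by
    refine ⟨fun _ => posSemidef_real_smul .one (inv_nonneg.2 hc.le), ?_⟩
    rw [Finset.sum_const, Finset.card_univ, ← Nat.cast_smul_eq_nsmul ℂ, smul_smul]
    have : ((Fintype.card u : ℂ)) ≠ 0 := by exact_mod_cast hc.ne'
    simp [this]
  refine lt_of_lt_of_le ?_ (score_le_pGuess hp hρ hP)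
  simp only [Matrix.mul_smul, Matrix.trace_smul, (hρ _).2, smul_eq_mul, mul_one,
    Complex.ofReal_re, ← Finset.sum_mul, hp.2, one_mul]
  exact inv_pos.2 hc

/-- Strong duality: the infimum in the min-entropy is attained at `log₂ P_guess`. -/
theorem logb_pGuess_mem (hp : IsProbDist p) (hρ : ∀ x, IsDensity (ρ x)) :
    Real.logb 2 (pGuess p ρ) ∈ minEntropyExponents p ρ := by
  obtain ⟨x₀⟩ := hp.nonempty
  have : Nonempty u := ⟨x₀⟩
  have := (hρ x₀).nonempty
  have hpos : ∀ x, ((p x : ℂ) • ρ x).PosSemidef := fun x => posSemidef_real_smul (hρ x).1 (hp.1 x)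
  obtain ⟨K, -, hKt, hKw⟩ := exists_common_upper_bound (g := pGuess p ρ)
    (fun x => (hpos x).isHermitian) (fun P hP => by
      simpa only [Matrix.smul_mul, Matrix.trace_smul, smul_eq_mul, Complex.re_ofReal_mul]
        using score_le_pGuess hp hρ hP)
  have hg := pGuess_pos hp hρ
  have hKpos : K.PosSemidef := by simpa using (hKw x₀).add (hpos x₀)
  -- The density operator is `K` normalized; the factor `2 ^ t` is its trace, `pGuess p ρ`.
  refine ⟨_, isDensity_inv_trace_smul hKpos (hKt ▸ hg), fun x => ?_⟩
  rw [Real.rpow_logb two_pos (by norm_num) hg, hKt, smul_smul, ← Complex.ofReal_mul,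
    mul_inv_cancel₀ hg.ne', Complex.ofReal_one, one_smul]
  exact hKw x

theorem logb_pGuess_le (hp : IsProbDist p) (hρ : ∀ x, IsDensity (ρ x)) {t : ℝ}
    (ht : t ∈ minEntropyExponents p ρ) : Real.logb 2 (pGuess p ρ) ≤ t := by
  have := hp.nonempty
  rw [Real.logb_le_iff_le_rpow one_lt_two (pGuess_pos hp hρ)]
  exact pGuess_le_rpow ht

/-- The min-entropy of a cq-state is `-log₂ P_guess`. -/
theorem condMinEntropy_cqState_eq [DecidableEq u] (hp : IsProbDist p)
    (hρ : ∀ x, IsDensity (ρ x)) :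
    condMinEntropy (cqState p ρ) = -Real.logb 2 (pGuess p ρ) := by
  have h : IsLeast (minEntropyExponents p ρ) (Real.logb 2 (pGuess p ρ)) :=
    ⟨logb_pGuess_mem hp hρ, fun _ ht => logb_pGuess_le hp hρ ht⟩
  rw [condMinEntropy_cqState, h.csInf_eq]

end Entropy

/-! ### Channels -/

section Channels

variable {a q r s : Type*} [Fintype a] [Fintype q] [Fintype r] [Fintype s]

theorem IsCompletelyPositive.idTensor_posSemidef {N : Matrix q q ℂ →ₗ[ℂ] Matrix r r ℂ}
    (hN : IsCompletelyPositive N) {M : Matrix (a × q) (a × q) ℂ} (hM : M.PosSemidef) :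
    (idTensor a N M).PosSemidef := by
  let e := Fintype.equivFin a
  have h := (hN _ _ (hM.submatrix (Prod.map e.symm id))).submatrix
    (Prod.map e id : a × r → Fin (Fintype.card a) × r)
  convert h using 1
  ext x y
  simp [idTensor]

theorem trace_idTensor {N : Matrix q q ℂ →ₗ[ℂ] Matrix r r ℂ}
    (hN : ∀ X, (N X).trace = X.trace) (M : Matrix (a × q) (a × q) ℂ) :
    (idTensor a N M).trace = M.trace := by
  simp only [Matrix.trace, Matrix.diag, Fintype.sum_prod_type]
  exact Finset.sum_congr rfl fun i _ => hN (Matrix.of fun k l => M (i, k) (i, l))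

theorem IsCPTP.isDensity_idTensor {N : Matrix q q ℂ →ₗ[ℂ] Matrix r r ℂ} (hN : IsCPTP N)
    {ρ : Matrix (a × q) (a × q) ℂ} (hρ : IsDensity ρ) : IsDensity (idTensor a N ρ) :=
  ⟨hN.1.idTensor_posSemidef hρ.1, by rw [trace_idTensor hN.2, hρ.2]⟩

theorem idTensor_comp {a q r s : Type*} (T : Matrix r r ℂ →ₗ[ℂ] Matrix s s ℂ)
    (N : Matrix q q ℂ →ₗ[ℂ] Matrix r r ℂ) (M : Matrix (a × q) (a × q) ℂ) :
    idTensor a (T ∘ₗ N) M = idTensor a T (idTensor a N M) := rfl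

/-- Local channels do not increase the guessing probability. -/
theorem IsCPTP.pGuess_idTensor_le {u : Type*} [Fintype u] [DecidableEq a] [DecidableEq r]
    [DecidableEq s] {T : Matrix r r ℂ →ₗ[ℂ] Matrix s s ℂ} (hT : IsCPTP T) {p : u → ℝ}
    (hp : IsProbDist p) {ρ : u → Matrix (a × r) (a × r) ℂ} (hρ : ∀ x, IsDensity (ρ x)) :
    pGuess p (fun x => idTensor a T (ρ x)) ≤ pGuess p ρ := by
  have hTρ := fun x => hT.isDensity_idTensor (hρ x)
  rw [← Real.logb_le_logb one_lt_two (pGuess_pos hp hTρ) (pGuess_pos hp hρ)]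
  -- Working with the dual program avoids the adjoint of `T`: the dominating operator is pushed
  -- forward by `id ⊗ T`.
  refine logb_pGuess_le hp hTρ ?_
  obtain ⟨σ, hσ, h⟩ := logb_pGuess_mem hp hρ
  refine ⟨idTensor a T σ, hT.isDensity_idTensor hσ, fun x => ?_⟩
  simpa only [map_sub, map_smul] using hT.1.idTensor_posSemidef (h x)

theorem kronecker_one_mul_mul_kronecker_one_apply [DecidableEq q] (V W : Matrix a a ℂ)
    (M : Matrix (a × q) (a × q) ℂ) (x y : a) (i j : q) :
    ((V ⊗ₖ (1 : Matrix q q ℂ)) * M * (W ⊗ₖ (1 : Matrix q q ℂ))) (x, i) (y, j) =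
      ∑ y', ∑ x', (V x x' * W y' y) * M (x', i) (y', j) := by
  simp only [Matrix.mul_apply, Fintype.sum_prod_type, Matrix.kroneckerMap_apply,
    Matrix.one_apply, mul_ite, mul_one, mul_zero, ite_mul, zero_mul, Finset.sum_ite_eq,
    Finset.sum_ite_eq', Finset.mem_univ, if_true, Finset.sum_mul]
  exact Finset.sum_congr rfl fun y' _ => Finset.sum_congr rfl fun x' _ => by ring

/-- Operators on the first factor only form scalar combinations of blocks, so they pass through `id
⊗ N`. -/
theorem idTensor_conj [DecidableEq q] [DecidableEq r] (N : Matrix q q ℂ →ₗ[ℂ] Matrix r r ℂ)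
    (V W : Matrix a a ℂ) (M : Matrix (a × q) (a × q) ℂ) :
    idTensor a N ((V ⊗ₖ (1 : Matrix q q ℂ)) * M * (W ⊗ₖ (1 : Matrix q q ℂ))) =
      (V ⊗ₖ (1 : Matrix r r ℂ)) * idTensor a N M * (W ⊗ₖ (1 : Matrix r r ℂ)) := by
  ext ⟨x, i⟩ ⟨y, j⟩
  rw [kronecker_one_mul_mul_kronecker_one_apply]
  have hblock : (Matrix.of fun i j =>
      ((V ⊗ₖ (1 : Matrix q q ℂ)) * M * (W ⊗ₖ (1 : Matrix q q ℂ))) (x, i) (y, j)) =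
      ∑ y', ∑ x', (V x x' * W y' y) • Matrix.of fun i j => M (x', i) (y', j) := by
    ext i j
    simp only [Matrix.of_apply, kronecker_one_mul_mul_kronecker_one_apply,
      Matrix.sum_apply, Matrix.smul_apply, smul_eq_mul]
  change N (Matrix.of fun i j =>
      ((V ⊗ₖ (1 : Matrix q q ℂ)) * M * (W ⊗ₖ (1 : Matrix q q ℂ))) (x, i) (y, j)) i j = _
  rw [hblock]
  simp only [map_sum, map_smul, Matrix.sum_apply, Matrix.smul_apply, smul_eq_mul]
  rfl

/-- The linear map with Choi matrix `J`. -/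
def ofChoi {s : Type*} (J : Matrix (r × s) (r × s) ℂ) : Matrix r r ℂ →ₗ[ℂ] Matrix s s ℂ where
  toFun X := Matrix.of fun x y => ∑ i, ∑ j, X i j * J (i, x) (j, y)
  map_add' X Y := by
    ext x y
    simp [add_mul, Finset.sum_add_distrib]
  map_smul' c X := by
    ext x y
    simp [mul_assoc, Finset.mul_sum]

theorem ofChoi_apply {s : Type*} (J : Matrix (r × s) (r × s) ℂ) (X : Matrix r r ℂ) (x y : s) :
    ofChoi J X x y = ∑ i, ∑ j, X i j * J (i, x) (j, y) := rfl

/-- The Choi matrix of a linear map. -/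
def choi {q s : Type*} [DecidableEq q] (M : Matrix q q ℂ →ₗ[ℂ] Matrix s s ℂ) : Matrix (q × s) (q × s) ℂ :=
  Matrix.of fun x y => M (Matrix.single x.1 y.1 1) x.2 y.2

/-- The Choi matrices of channels. -/
def channelChoi (r s : Type*) [Fintype r] [DecidableEq r] [Fintype s] :
    Set (Matrix (r × s) (r × s) ℂ) :=
  {J | J.PosSemidef ∧ ∀ i j, ∑ x, J (i, x) (j, x) = if i = j then 1 else 0}

theorem isCompletelyPositive_ofChoi {J : Matrix (r × s) (r × s) ℂ} (hJ : J.PosSemidef) :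
    IsCompletelyPositive (ofChoi J) := by
  intro k M hM
  -- The image of `M` is `M ⊗ J` with the two copies of `r` identified and summed out.
  have h := posSemidef_sum_blocks ((hM.kronecker hJ).submatrix
    fun z : (Fin k × s) × r => ((z.1.1, z.2), (z.2, z.1.2)))
  convert h using 1
  ext x y
  simp [idTensor, ofChoi_apply, Matrix.kroneckerMap_apply]

theorem isCPTP_ofChoi [DecidableEq r] {J : Matrix (r × s) (r × s) ℂ} (hJ : J ∈ channelChoi r s) :
    IsCPTP (ofChoi J) := by
  refine ⟨isCompletelyPositive_ofChoi hJ.1, fun X => ?_⟩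
  simp only [Matrix.trace, Matrix.diag, ofChoi_apply]
  rw [Finset.sum_comm]
  refine Finset.sum_congr rfl fun i _ => ?_
  rw [Finset.sum_comm]
  simp [← Finset.mul_sum, hJ.2]

theorem convex_channelChoi [DecidableEq r] : Convex ℝ (channelChoi r s) := by
  intro J hJ J' hJ' a b ha hb hab
  refine ⟨(hJ.1.smul ha).add (hJ'.1.smul hb), fun i j => ?_⟩
  simp only [Matrix.add_apply, Matrix.smul_apply, Finset.sum_add_distrib, ← Finset.smul_sum,
    hJ.2, hJ'.2, ← add_smul, hab, one_smul]

/-- Trace preservation fixes the trace of `J` to `|r|`, which bounds every entry of a positive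
semidefinite matrix. -/
theorem isCompact_channelChoi [DecidableEq r] : IsCompact (channelChoi r s) := by
  have hclosed : IsClosed (channelChoi r s) := by
    simp only [channelChoi, Set.ofPred_and, Set.ofPred_forall]
    refine isClosed_posSemidef.inter (isClosed_iInter fun i => isClosed_iInter fun j => ?_)
    exact isClosed_eq (continuous_finsetSum _ fun x _ => continuous_id.matrix_elem _ _)
      continuous_const
  have hc : IsCompact (Set.pi Set.univ fun _ : r × s => Set.pi Set.univ fun _ : r × s =>
      Metric.closedBall (0 : ℂ) (Fintype.card r)) :=
    isCompact_univ_pi fun _ => isCompact_univ_pi fun _ => isCompact_closedBall _ _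
  refine hc.of_isClosed_subset hclosed fun (J : Matrix (r × s) (r × s) ℂ) hJ x _ y _ => ?_
  have htr : J.trace = Fintype.card r := by
    simp only [Matrix.trace, Matrix.diag, Fintype.sum_prod_type, hJ.2]
    simp
  have := norm_apply_le_re_trace hJ.1 x y
  rw [htr, Complex.natCast_re] at this
  simpa using this

theorem eq_sum_smul_single [DecidableEq q] (X : Matrix q q ℂ) :
    X = ∑ i, ∑ j, X i j • Matrix.single i j (1 : ℂ) := by
  conv_lhs => rw [Matrix.matrix_eq_sum_single X]
  simp

theorem apply_eq_sum_choi {s : Type*} [DecidableEq q] (M : Matrix q q ℂ →ₗ[ℂ] Matrix s s ℂ)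
    (X : Matrix q q ℂ) (x y : s) : M X x y = ∑ i, ∑ j, X i j * choi M (i, x) (j, y) := by
  conv_lhs => rw [eq_sum_smul_single X]
  simp only [map_sum, map_smul, Matrix.sum_apply, Matrix.smul_apply, smul_eq_mul]
  rfl

theorem choi_injective {s : Type*} [DecidableEq q] {M M' : Matrix q q ℂ →ₗ[ℂ] Matrix s s ℂ}
    (h : choi M = choi M') : M = M' := by
  ext X x y
  simp only [apply_eq_sum_choi, h]

theorem IsCompletelyPositive.choi_posSemidef [DecidableEq q]
    {M : Matrix q q ℂ →ₗ[ℂ] Matrix s s ℂ} (hM : IsCompletelyPositive M) :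
    (choi M).PosSemidef := by
  -- The Choi matrix is the image of the unnormalized maximally entangled state.
  convert hM.idTensor_posSemidef (Matrix.posSemidef_vecMulVec_self_star
    (fun x : q × q => if x.1 = x.2 then (1 : ℂ) else 0)) using 1
  ext ⟨i, x⟩ ⟨j, y⟩
  have hblock : Matrix.single i j (1 : ℂ) = Matrix.of fun k l => Matrix.vecMulVec
      (fun x : q × q => if x.1 = x.2 then (1 : ℂ) else 0)
      (star fun x : q × q => if x.1 = x.2 then (1 : ℂ) else 0) (i, k) (j, l) := by
    ext k l
    simp only [Matrix.single_apply, Matrix.of_apply, Matrix.vecMulVec_apply, Pi.star_apply]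
    by_cases h : i = k <;> by_cases h' : j = l <;> simp [h, h']
  exact congrFun (congrFun (congrArg M hblock) x) y

theorem IsCompletelyPositive.comp {N : Matrix q q ℂ →ₗ[ℂ] Matrix r r ℂ}
    {T : Matrix r r ℂ →ₗ[ℂ] Matrix s s ℂ} (hT : IsCompletelyPositive T)
    (hN : IsCompletelyPositive N) : IsCompletelyPositive (T ∘ₗ N) :=
  fun k M hM => hT k _ (hN k M hM)

theorem IsCPTP.comp {N : Matrix q q ℂ →ₗ[ℂ] Matrix r r ℂ}
    {T : Matrix r r ℂ →ₗ[ℂ] Matrix s s ℂ} (hT : IsCPTP T) (hN : IsCPTP N) : IsCPTP (T ∘ₗ N) :=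
  ⟨hT.1.comp hN.1, fun X => by rw [LinearMap.comp_apply, hT.2, hN.2]⟩

end Channels

/-! ### Separation of channels by guessing games -/

section Separation

variable {q r s s' : Type*} [Fintype q] [Fintype r] [Fintype s] [Fintype s']

/-- The overlap `d Tr[(id ⊗ M)(H) Φ]` with the maximally entangled state `Φ` that belongs to an
identification `e` of the bases of `ℋ_{S'}` and `ℋ_S`. -/
def overlap {q s : Type*} (e : s' ≃ s) (M : Matrix q q ℂ →ₗ[ℂ] Matrix s s ℂ)
    (H : Matrix (s' × q) (s' × q) ℂ) : ℂ :=
  ∑ i, ∑ j, idTensor s' M H (i, e i) (j, e j)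

/-- Realignment: a functional on Choi matrices becomes an operator on `S'Q`, namely the transpose of
`K` with its factors swapped and relabelled by `e`. -/
theorem trace_mul_choi [DecidableEq q] (e : s' ≃ s) (M : Matrix q q ℂ →ₗ[ℂ] Matrix s s ℂ)
    (K : Matrix (q × s) (q × s) ℂ) :
    (K * choi M).trace = overlap e M (Matrix.of fun x y => K (y.2, e y.1) (x.2, e x.1)) := by
  have h : ∀ i j, idTensor s' M (Matrix.of fun x y => K (y.2, e y.1) (x.2, e x.1))
      (i, e i) (j, e j) = ∑ k, ∑ l, K (l, e j) (k, e i) * choi M (k, e i) (l, e j) :=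
    fun i j => apply_eq_sum_choi M _ _ _
  rw [Matrix.trace_mul_comm]
  simp only [overlap, h, Matrix.trace, Matrix.diag, Matrix.mul_apply, Fintype.sum_prod_type]
  rw [Finset.sum_comm, ← e.sum_comp]
  refine Finset.sum_congr rfl fun i _ => ?_
  conv_rhs => rw [Finset.sum_comm]
  refine Finset.sum_congr rfl fun k _ => ?_
  conv_rhs => rw [Finset.sum_comm]
  refine Finset.sum_congr rfl fun l _ => ?_
  rw [← e.sum_comp]
  exact Finset.sum_congr rfl fun j _ => mul_comm _ _

theorem overlap_add {q s : Type*} (e : s' ≃ s) (M : Matrix q q ℂ →ₗ[ℂ] Matrix s s ℂ)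
    (H H' : Matrix (s' × q) (s' × q) ℂ) :
    overlap e M (H + H') = overlap e M H + overlap e M H' := by
  simp [overlap, Finset.sum_add_distrib]

theorem overlap_smul {q s : Type*} (e : s' ≃ s) (M : Matrix q q ℂ →ₗ[ℂ] Matrix s s ℂ) (c : ℂ)
    (H : Matrix (s' × q) (s' × q) ℂ) : overlap e M (c • H) = c * overlap e M H := by
  simp [overlap, Finset.mul_sum]

/-- The value does not depend on `M`, so adding a multiple of the identity shifts both sides of a
separation equally. -/
theorem overlap_one [DecidableEq q] [DecidableEq s'] (e : s' ≃ s)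
    {M : Matrix q q ℂ →ₗ[ℂ] Matrix s s ℂ} (hM : ∀ X, (M X).trace = X.trace) :
    overlap e M 1 = Fintype.card q := by
  rw [← Matrix.one_kronecker_one (m := s') (n := q) (α := ℂ), overlap, idTensor_kronecker]
  simp only [Matrix.kroneckerMap_apply, Matrix.one_apply, ite_mul, one_mul, zero_mul,
    Finset.sum_ite_eq, Finset.mem_univ, if_true]
  rw [e.sum_comp (fun x => M 1 x x), ← Matrix.trace_one (n := q) (R := ℂ), ← hM 1]
  rfl

/-- If `N'` is not of the form `T ∘ N`, some state has strictly larger overlap with the maximally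
entangled state after `N'` than after any `T ∘ N`. -/
theorem exists_density_overlap_lt [DecidableEq q] [Nonempty q] [DecidableEq r]
    [Nonempty s'] (e : s' ≃ s)
    {N : Matrix q q ℂ →ₗ[ℂ] Matrix r r ℂ} {N' : Matrix q q ℂ →ₗ[ℂ] Matrix s s ℂ}
    (hN : IsCPTP N) (hN' : IsCPTP N') (h : ¬ IsDegradableInto N N') :
    ∃ (ρ : Matrix (s' × q) (s' × q) ℂ) (v : ℝ), IsDensity ρ ∧ v < (overlap e N' ρ).re ∧
      ∀ J ∈ channelChoi r s, (overlap e (ofChoi J ∘ₗ N) ρ).re < v := by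
  classical
  let Λ : Matrix (r × s) (r × s) ℂ →ₗ[ℝ] Matrix (q × s) (q × s) ℂ :=
    { toFun J := choi (ofChoi J ∘ₗ N)
      map_add' J J' := by
        ext x y
        simp [choi, ofChoi_apply, mul_add, Finset.sum_add_distrib]
      map_smul' c J := by
        ext x y
        simp [choi, ofChoi_apply, Finset.mul_sum, mul_left_comm] }
  have hΛc : Continuous Λ := LinearMap.continuous_of_finiteDimensional Λ
  have hnot : choi N' ∉ Λ '' channelChoi r s := by
    rintro ⟨J, hJ, hJe⟩
    exact h ⟨ofChoi J, isCPTP_ofChoi hJ, (choi_injective hJe).symm⟩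
  have hlc : LocallyConvexSpace ℝ (Matrix (q × s) (q × s) ℂ) :=
    inferInstanceAs (LocallyConvexSpace ℝ (q × s → q × s → ℂ))
  obtain ⟨f, v, hfv, hv⟩ := geometric_hahn_banach_closed_point
    (convex_channelChoi.linear_image Λ) (isCompact_channelChoi.image hΛc).isClosed hnot
  obtain ⟨K, hK, hKf⟩ := exists_isHermitian_re_trace_repr (f : Matrix (q × s) (q × s) ℂ →ₗ[ℝ] ℝ)
  let H : Matrix (s' × q) (s' × q) ℂ := Matrix.of fun x y => K (y.2, e y.1) (x.2, e x.1)
  have hH : H.IsHermitian := by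
    ext x y
    exact congrFun (congrFun hK.eq (y.2, e y.1)) (x.2, e x.1)
  have hov : ∀ M : Matrix q q ℂ →ₗ[ℂ] Matrix s s ℂ, IsCPTP M →
      f (choi M) = (overlap e M H).re := by
    intro M hM
    rw [← trace_mul_choi]
    exact hKf _ hM.1.choi_posSemidef.isHermitian
  obtain ⟨c, hc, hcH⟩ := exists_posSemidef_smul_one_add hH
  -- The extra `1` keeps the trace positive even if `c • 1 + H = 0`, so that `G` can be normalized.
  let G : Matrix (s' × q) (s' × q) ℂ := ((c + 1 : ℝ) : ℂ) • 1 + H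
  have hGeq : G = (c : ℂ) • 1 + H + 1 := by
    simp only [G, Complex.ofReal_add, Complex.ofReal_one, add_smul, one_smul]
    abel
  have hG : G.PosSemidef := hGeq ▸ hcH.add .one
  have hGtr : 0 < G.trace.re := by
    rw [hGeq, Matrix.trace_add, Complex.add_re, Matrix.trace_one, Complex.natCast_re]
    have h1 := (Complex.le_def.1 hcH.trace_nonneg).1
    have h2 : (0 : ℝ) < Fintype.card (s' × q) := by exact_mod_cast Fintype.card_pos
    simp only [Complex.zero_re] at h1
    linarith
  have hovG : ∀ M : Matrix q q ℂ →ₗ[ℂ] Matrix s s ℂ, IsCPTP M →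
      (overlap e M (((G.trace.re⁻¹ : ℝ) : ℂ) • G)).re =
        G.trace.re⁻¹ * ((c + 1) * Fintype.card q + f (choi M)) := by
    intro M hM
    rw [overlap_smul, Complex.re_ofReal_mul, hov M hM, overlap_add, overlap_smul,
      overlap_one e hM.2, Complex.add_re, Complex.re_ofReal_mul, Complex.natCast_re]
  refine ⟨((G.trace.re⁻¹ : ℝ) : ℂ) • G, G.trace.re⁻¹ * ((c + 1) * Fintype.card q + v),
    isDensity_inv_trace_smul hG hGtr, ?_, fun J hJ => ?_⟩
  · rw [hovG _ hN']
    exact mul_lt_mul_of_pos_left (by linarith) (inv_pos.2 hGtr)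
  · rw [hovG _ ((isCPTP_ofChoi hJ).comp hN)]
    have := hfv _ ⟨J, hJ, rfl⟩
    exact mul_lt_mul_of_pos_left (by simpa [Λ] using this) (inv_pos.2 hGtr)

end Separation

/-! ### Heisenberg–Weyl unitaries. -/

section Teleportation

/-- The Heisenberg–Weyl unitaries: an orthogonal basis of unitary matrices. -/
theorem exists_unitary_basis {s' : Type*} [Fintype s'] [DecidableEq s'] {d : ℕ} [NeZero d]
    (hd : Fintype.card s' = d) :
    ∃ V : ZMod d × ZMod d → Matrix s' s' ℂ, (∀ u, (V u).conjTranspose * V u = 1) ∧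
      ∀ i k j l, ∑ u, V u i k * star (V u j l) = if i = j ∧ k = l then (d : ℂ) else 0 := by
  let φ : s' ≃ ZMod d := Fintype.equivOfCardEq (by rw [hd, ZMod.card])
  let χ : AddChar (ZMod d) ℂ := ZMod.stdAddChar
  have hχ : ∀ x y, χ x * star (χ y) = χ (x - y) := by
    intro x y
    rw [sub_eq_add_neg, AddChar.map_add_eq_mul, AddChar.map_neg_eq_conj]
    rfl
  have hsum : ∀ b : ZMod d, ∑ x, χ (x * b) = if b = 0 then (d : ℂ) else 0 := by
    intro b
    have := AddChar.sum_mulShift b (ZMod.isPrimitive_stdAddChar d)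
    rw [this, ZMod.card]
    push_cast
    rfl
  -- Phase by the character, then cyclic shift: `V (a, b)` sends `|k⟩` to `χ(bk) |k + a⟩`.
  refine ⟨fun u => Matrix.of fun i k => if φ i = φ k + u.1 then χ (u.2 * φ k) else 0, ?_, ?_⟩
  · rintro ⟨a, b⟩
    ext k l
    simp only [Matrix.mul_apply, Matrix.conjTranspose_apply, Matrix.of_apply, Matrix.one_apply]
    rw [Finset.sum_eq_single (φ.symm (φ l + a))]
    · by_cases h : k = l
      · subst h
        simp only [Equiv.apply_symm_apply, if_true]
        rw [mul_comm]
        simpa using hχ (b * φ k) (b * φ k)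
      · have : ¬ l = k := fun h' => h h'.symm
        simp [h, this]
    · intro i _ hi
      have : φ i ≠ φ l + a := fun h => hi (by rw [← h, Equiv.symm_apply_apply])
      simp [this]
    · simp
  · intro i k j l
    simp only [Matrix.of_apply, Fintype.sum_prod_type]
    -- Character orthogonality in `b` forces `k = l`; then the shift `a` is determined and forces `i
    -- = j`.
    have hterm : ∀ a, ∑ b, (if φ i = φ k + a then χ (b * φ k) else 0) *
        star (if φ j = φ l + a then χ (b * φ l) else 0) =
        if φ i = φ k + a ∧ φ j = φ l + a then (if k = l then (d : ℂ) else 0) else 0 := by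
      intro a
      by_cases h1 : φ i = φ k + a <;> by_cases h2 : φ j = φ l + a <;>
        simp only [h1, h2, if_true, if_false, and_true, and_false, zero_mul, star_zero, mul_zero,
          Finset.sum_const_zero, hχ, ← mul_sub, hsum, sub_eq_zero, φ.injective.eq_iff]
    simp only [hterm]
    by_cases hkl : k = l
    · subst hkl
      rw [Finset.sum_eq_single (φ i - φ k)]
      · simp [eq_comm]
      · intro a _ ha
        have : φ i ≠ φ k + a := fun h => ha (by rw [h, add_sub_cancel_left])
        simp [this]
      · simp
    · simp [hkl]

end Teleportation

/-! ### The game of guessing a rotation. -/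

section Measurements

variable {q r s s' : Type*} [Fintype q] [Fintype r] [Fintype s] [Fintype s']

/-- The unnormalized maximally entangled state, as a matrix. -/
def maxEntangled {s s' : Type*} [DecidableEq s] (e : s' ≃ s) : Matrix (s' × s) (s' × s) ℂ :=
  Matrix.vecMulVec (fun x => if e x.1 = x.2 then 1 else 0)
    (star fun x => if e x.1 = x.2 then 1 else 0)

theorem trace_mul_maxEntangled {q : Type*} [DecidableEq s] (e : s' ≃ s)
    (M : Matrix q q ℂ →ₗ[ℂ] Matrix s s ℂ) (H : Matrix (s' × q) (s' × q) ℂ) :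
    (idTensor s' M H * maxEntangled e).trace = overlap e M H := by
  rw [maxEntangled, Matrix.mul_vecMulVec, Matrix.trace_vecMulVec]
  simp only [dotProduct, Matrix.mulVec, Fintype.sum_prod_type, Pi.star_apply, overlap]
  simp [apply_ite star]

theorem overlap_ofChoi_comp {q s : Type*} (e : s' ≃ s) (J : Matrix (r × s) (r × s) ℂ)
    (N : Matrix q q ℂ →ₗ[ℂ] Matrix r r ℂ) (H : Matrix (s' × q) (s' × q) ℂ) :
    overlap e (ofChoi J ∘ₗ N) H =
      ∑ i, ∑ j, ∑ k, ∑ l, idTensor s' N H (i, k) (j, l) * J (k, e i) (l, e j) := by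
  simp only [overlap, idTensor, LinearMap.coe_mk, AddHom.coe_mk, Matrix.of_apply,
    LinearMap.comp_apply, ofChoi_apply]

theorem conjTranspose_kronecker_one {q s' : Type*} [DecidableEq q] (V : Matrix s' s' ℂ) :
    (V ⊗ₖ (1 : Matrix q q ℂ)).conjTranspose = V.conjTranspose ⊗ₖ (1 : Matrix q q ℂ) := by
  rw [Matrix.conjTranspose_kronecker, Matrix.conjTranspose_one]

/-- Cyclicity of the trace moves the rotations from the states to the measurement. -/
theorem sum_trace_conj_mul [DecidableEq r] {u : Type*} [Fintype u] (V : u → Matrix s' s' ℂ)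
    (X : Matrix (s' × r) (s' × r) ℂ) (P : u → Matrix (s' × r) (s' × r) ℂ) :
    ∑ x, ((V x ⊗ₖ (1 : Matrix r r ℂ)) * X * ((V x).conjTranspose ⊗ₖ (1 : Matrix r r ℂ)) *
      P x).trace = (X * ∑ x, ((V x).conjTranspose ⊗ₖ (1 : Matrix r r ℂ)) * P x *
        (V x ⊗ₖ (1 : Matrix r r ℂ))).trace := by
  rw [Matrix.mul_sum, Matrix.trace_sum]
  refine Finset.sum_congr rfl fun x _ => ?_
  rw [Matrix.mul_assoc, Matrix.mul_assoc, Matrix.trace_mul_comm]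
  simp only [Matrix.mul_assoc]

variable [DecidableEq s']

theorem conjTranspose_kronecker_one_mul_self [DecidableEq q] {V : Matrix s' s' ℂ}
    (hV : V.conjTranspose * V = 1) :
    (V.conjTranspose ⊗ₖ (1 : Matrix q q ℂ)) * (V ⊗ₖ (1 : Matrix q q ℂ)) = 1 := by
  rw [← Matrix.mul_kronecker_mul, hV, Matrix.one_mul, Matrix.one_kronecker_one]

theorem isDensity_conj [DecidableEq q] {V : Matrix s' s' ℂ} (hV : V.conjTranspose * V = 1)
    {ρ : Matrix (s' × q) (s' × q) ℂ} (hρ : IsDensity ρ) :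
    IsDensity ((V ⊗ₖ (1 : Matrix q q ℂ)) * ρ * (V.conjTranspose ⊗ₖ (1 : Matrix q q ℂ))) := by
  constructor
  · rw [← conjTranspose_kronecker_one]
    exact hρ.1.mul_mul_conjTranspose_same _
  · rw [Matrix.trace_mul_comm, ← Matrix.mul_assoc, conjTranspose_kronecker_one_mul_self hV,
      Matrix.one_mul, hρ.2]

/-- The rotated maximally entangled states form a measurement. -/
theorem isPOVM_maxEntangled [DecidableEq s] {u : Type*} [Fintype u] (e : s' ≃ s) {d : ℕ}
    [NeZero d] {V : u → Matrix s' s' ℂ}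
    (hV : ∀ i k j l, ∑ u, V u i k * star (V u j l) = if i = j ∧ k = l then (d : ℂ) else 0) :
    IsPOVM fun u => (V u ⊗ₖ (1 : Matrix s s ℂ)) * ((((d : ℝ)⁻¹ : ℝ) : ℂ) • maxEntangled e) *
      ((V u).conjTranspose ⊗ₖ (1 : Matrix s s ℂ)) := by
  constructor
  · intro u
    beta_reduce
    rw [← conjTranspose_kronecker_one]
    exact (posSemidef_real_smul (Matrix.posSemidef_vecMulVec_self_star _)
      (by positivity)).mul_mul_conjTranspose_same _
  · have hd : (d : ℂ) ≠ 0 := by exact_mod_cast NeZero.ne d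
    ext ⟨i, x⟩ ⟨j, y⟩
    have hentry : ∀ u, ((V u ⊗ₖ (1 : Matrix s s ℂ)) *
        ((((d : ℝ)⁻¹ : ℝ) : ℂ) • maxEntangled e) *
        ((V u).conjTranspose ⊗ₖ (1 : Matrix s s ℂ))) (i, x) (j, y) =
        (d : ℂ)⁻¹ * (V u i (e.symm x) * star (V u j (e.symm y))) := by
      intro u
      rw [kronecker_one_mul_mul_kronecker_one_apply, Finset.sum_eq_single (e.symm y),
        Finset.sum_eq_single (e.symm x)]
      · simp [maxEntangled, Matrix.vecMulVec_apply]
        ring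
      · intro x' _ hx'
        have : ¬ e x' = x := fun h => hx' (by rw [← h, Equiv.symm_apply_apply])
        simp [maxEntangled, Matrix.vecMulVec_apply, this]
      · simp
      · intro y' _ hy'
        have : ¬ e y' = y := fun h => hy' (by rw [← h, Equiv.symm_apply_apply])
        simp [maxEntangled, Matrix.vecMulVec_apply, this]
      · simp
    rw [Matrix.sum_apply]
    simp only [hentry]
    rw [← Finset.mul_sum, hV, Matrix.one_apply]
    simp only [Prod.mk.injEq, e.symm.injective.eq_iff, mul_ite, inv_mul_cancel₀ hd, mul_zero]

/-- Any measurement of the rotated states acts as a channel followed by the projection onto the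
maximally entangled state. -/
theorem exists_channelChoi_overlap {q : Type*} [DecidableEq r] {u : Type*} [Fintype u] (e : s' ≃ s) {d : ℕ}
    [NeZero d] (hd : Fintype.card s' = d) {V : u → Matrix s' s' ℂ}
    (hV : ∀ u, (V u).conjTranspose * V u = 1) {P : u → Matrix (s' × r) (s' × r) ℂ}
    (hP : IsPOVM P) :
    ∃ J ∈ channelChoi r s, ∀ (N : Matrix q q ℂ →ₗ[ℂ] Matrix r r ℂ)
      (ρ : Matrix (s' × q) (s' × q) ℂ),
      ∑ x, ((V x ⊗ₖ (1 : Matrix r r ℂ)) * idTensor s' N ρ *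
        ((V x).conjTranspose ⊗ₖ (1 : Matrix r r ℂ)) * P x).trace =
          d * overlap e (ofChoi J ∘ₗ N) ρ := by
  have hd0 : (d : ℂ) ≠ 0 := by exact_mod_cast NeZero.ne d
  set S := ∑ x, ((V x).conjTranspose ⊗ₖ (1 : Matrix r r ℂ)) * P x *
    (V x ⊗ₖ (1 : Matrix r r ℂ)) with hS
  have hSpos : S.PosSemidef := by
    refine Matrix.posSemidef_sum _ fun x _ => ?_
    rw [← conjTranspose_kronecker_one]
    exact (hP.1 x).conjTranspose_mul_mul_same _
  -- A unitary on `S'` leaves the partial trace over `S'` unchanged, so `S` has the same partial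
  -- trace as `∑ P x = 1`, namely `d • 1`.
  have hconj : ∀ x k l, ∑ i, (((V x).conjTranspose ⊗ₖ (1 : Matrix r r ℂ)) * P x *
      (V x ⊗ₖ (1 : Matrix r r ℂ))) (i, k) (i, l) = ∑ i, P x (i, k) (i, l) := by
    intro x k l
    have hV' : ∀ i j, ∑ y, (V x).conjTranspose y i * V x j y = if j = i then 1 else 0 := by
      intro i j
      have hVV : V x * (V x).conjTranspose = 1 := mul_eq_one_comm.1 (hV x)
      have := congrFun (congrFun hVV j) i
      rw [Matrix.mul_apply, Matrix.one_apply] at this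
      rw [← this]
      exact Finset.sum_congr rfl fun y _ => mul_comm _ _
    simp only [kronecker_one_mul_mul_kronecker_one_apply]
    rw [Finset.sum_comm]
    refine Finset.sum_congr rfl fun j _ => ?_
    rw [Finset.sum_comm]
    simp only [← Finset.sum_mul, hV']
    simp
  have hSpartial : ∀ k l, ∑ i, S (i, k) (i, l) = if k = l then (d : ℂ) else 0 := by
    intro k l
    simp only [hS, Matrix.sum_apply]
    rw [Finset.sum_comm]
    simp only [hconj]
    rw [Finset.sum_comm]
    simp only [← Matrix.sum_apply, hP.2, Matrix.one_apply, Prod.mk.injEq, true_and]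
    split_ifs <;> simp [hd]
  -- The transpose turns `Tr[X S]` into the index contraction defining the overlap; dividing by `d`
  -- normalizes the partial trace.
  let J : Matrix (r × s) (r × s) ℂ := (((d : ℝ)⁻¹ : ℝ) : ℂ) •
    S.transpose.submatrix (fun x => (e.symm x.2, x.1)) (fun x => (e.symm x.2, x.1))
  have hJ : ∀ k i l j, J (k, i) (l, j) = (d : ℂ)⁻¹ * S (e.symm j, l) (e.symm i, k) := by
    intro k i l j
    simp [J]
  have hJpos : J.PosSemidef :=
    posSemidef_real_smul (hSpos.transpose.submatrix _) (inv_nonneg.2 d.cast_nonneg)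
  have hJtr : ∀ k l, ∑ x, J (k, x) (l, x) = if k = l then 1 else 0 := by
    intro k l
    simp only [hJ, ← Finset.mul_sum]
    rw [e.symm.sum_comp (fun i => S (i, l) (i, k)), hSpartial]
    simp [hd0, eq_comm]
  refine ⟨J, ⟨hJpos, hJtr⟩, fun N ρ => ?_⟩
  rw [sum_trace_conj_mul, ← hS, overlap_ofChoi_comp]
  simp only [Matrix.trace, Matrix.diag, Matrix.mul_apply, Fintype.sum_prod_type, hJ,
    Equiv.symm_apply_apply, Finset.mul_sum]
  refine Finset.sum_congr rfl fun i _ => ?_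
  rw [Finset.sum_comm]
  refine Finset.sum_congr rfl fun j _ => Finset.sum_congr rfl fun k _ =>
    Finset.sum_congr rfl fun l _ => ?_
  field_simp

/-- A channel that is never worse in guessing games can be degraded into the other one. -/
theorem isDegradableInto_of_pGuess_le [DecidableEq q] [Nonempty q] [DecidableEq r]
    [DecidableEq s] (hs' : Fintype.card s' = Fintype.card s)
    {N : Matrix q q ℂ →ₗ[ℂ] Matrix r r ℂ} {N' : Matrix q q ℂ →ₗ[ℂ] Matrix s s ℂ}
    (hN : IsCPTP N) (hN' : IsCPTP N')
    (h : ∀ (U : Type) [Fintype U] (p : U → ℝ) (ρ : U → Matrix (s' × q) (s' × q) ℂ),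
      IsProbDist p → (∀ u, IsDensity (ρ u)) →
      pGuess p (fun u => idTensor s' N' (ρ u)) ≤ pGuess p (fun u => idTensor s' N (ρ u))) :
    IsDegradableInto N N' := by
  by_contra hdeg
  -- Empty `s'` would make `s` empty, and trace preservation of `N'` would then give `|q| = 0`.
  have hne : Nonempty s' := by
    by_contra hemp
    rw [not_nonempty_iff, ← Fintype.card_eq_zero_iff, hs', Fintype.card_eq_zero_iff] at hemp
    have := hN'.2 1
    rw [Matrix.trace_one] at this
    simp [Matrix.trace, eq_comm] at this
  let e : s' ≃ s := Fintype.equivOfCardEq hs'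
  obtain ⟨ρ, v, hρ, hv', hv⟩ := exists_density_overlap_lt e hN hN' hdeg
  obtain ⟨d, hd⟩ : ∃ d, Fintype.card s' = d := ⟨_, rfl⟩
  have : NeZero d := ⟨hd ▸ Fintype.card_ne_zero⟩
  have hd0 : (0 : ℝ) < d := by exact_mod_cast NeZero.pos d
  obtain ⟨V, hVu, hV⟩ := exists_unitary_basis hd
  let p : ZMod d × ZMod d → ℝ := fun _ => ((d : ℝ) * d)⁻¹
  have hcard : ∑ _u : ZMod d × ZMod d, ((d : ℝ) * d)⁻¹ = 1 := by
    rw [Finset.sum_const, Finset.card_univ, Fintype.card_prod, ZMod.card, nsmul_eq_mul]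
    push_cast
    field_simp
  have hp : IsProbDist p := ⟨fun _ => by positivity, hcard⟩
  let ω : ZMod d × ZMod d → Matrix (s' × q) (s' × q) ℂ := fun u =>
    (V u ⊗ₖ (1 : Matrix q q ℂ)) * ρ * ((V u).conjTranspose ⊗ₖ (1 : Matrix q q ℂ))
  have hω : ∀ u, IsDensity (ω u) := fun u => isDensity_conj (hVu u) hρ
  have hlow : (d : ℝ)⁻¹ * (overlap e N' ρ).re ≤ pGuess p (fun u => idTensor s' N' (ω u)) := by
    refine le_of_eq_of_le ?_ (score_le_pGuess hp (fun u => hN'.isDensity_idTensor (hω u))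
      (isPOVM_maxEntangled e hV))
    have hterm : ∀ u, (idTensor s' N' (ω u) * ((V u ⊗ₖ (1 : Matrix s s ℂ)) *
        ((((d : ℝ)⁻¹ : ℝ) : ℂ) • maxEntangled e) *
        ((V u).conjTranspose ⊗ₖ (1 : Matrix s s ℂ)))).trace.re =
        (d : ℝ)⁻¹ * (overlap e N' ρ).re := by
      intro u
      rw [idTensor_conj, Matrix.trace_mul_comm]
      have hassoc : ∀ A B C D : Matrix (s' × s) (s' × s) ℂ,
          (A * B * C * (A * D * C)) = A * (B * ((C * A) * (D * C))) := by
        intro A B C D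
        simp only [Matrix.mul_assoc]
      rw [hassoc, conjTranspose_kronecker_one_mul_self (hVu u), Matrix.one_mul,
        Matrix.trace_mul_comm]
      simp only [Matrix.mul_assoc]
      rw [conjTranspose_kronecker_one_mul_self (hVu u), Matrix.mul_one, Matrix.smul_mul,
        Matrix.trace_smul, Matrix.trace_mul_comm, trace_mul_maxEntangled, smul_eq_mul,
        Complex.re_ofReal_mul]
    simp only [hterm, p]
    rw [← Finset.sum_mul, hcard, one_mul]
  -- Passing to the supremum over POVMs loses strictness; the gap between `v` and the overlap of
  -- `N'` preserves the contradiction.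
  have hup : pGuess p (fun u => idTensor s' N (ω u)) ≤ (d : ℝ)⁻¹ * v := by
    obtain ⟨P₀, hP₀⟩ := exists_isPOVM (u := ZMod d × ZMod d) (n := s' × r)
    refine csSup_le ⟨_, P₀, hP₀, rfl⟩ ?_
    rintro _ ⟨P, hP, rfl⟩
    obtain ⟨J, hJ, hJo⟩ := exists_channelChoi_overlap (q := q) e hd hVu hP
    have hsum : ∑ u, p u * (idTensor s' N (ω u) * P u).trace.re =
        (d : ℝ)⁻¹ * (overlap e (ofChoi J ∘ₗ N) ρ).re := by
      simp only [p, ← Finset.mul_sum, ω, idTensor_conj]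
      rw [← Complex.re_sum, hJo, ← Complex.ofReal_natCast, Complex.re_ofReal_mul]
      field_simp
    rw [hsum]
    exact mul_le_mul_of_nonneg_left (hv J hJ).le (by positivity)
  have := h _ p ω hp hω
  have hlt := mul_lt_mul_of_pos_left hv' (inv_pos.2 hd0)
  linarith

end Measurements

end QuantumComparison

open QuantumComparison in
theorem mainTheorem3 {q r s s' : Type*} [Fintype q] [DecidableEq q] [Nonempty q]
    [Fintype r] [DecidableEq r] [Fintype s] [DecidableEq s] [Fintype s'] [DecidableEq s']
    (hs' : Fintype.card s' = Fintype.card s)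
    (N : Matrix q q ℂ →ₗ[ℂ] Matrix r r ℂ) (N' : Matrix q q ℂ →ₗ[ℂ] Matrix s s ℂ)
    (hN : IsCPTP N) (hN' : IsCPTP N') :
    [ ∀ (U : Type) [Fintype U] [DecidableEq U] (p : U → ℝ)
        (ρ : U → Matrix (s' × q) (s' × q) ℂ), IsProbDist p → (∀ u, IsDensity (ρ u)) →
        condMinEntropy (cqState p fun u => idTensor s' N (ρ u)) ≤
          condMinEntropy (cqState p fun u => idTensor s' N' (ρ u)),
      ∀ (U : Type) [Fintype U] (p : U → ℝ)
        (ρ : U → Matrix (s' × q) (s' × q) ℂ), IsProbDist p → (∀ u, IsDensity (ρ u)) →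
        pGuess p (fun u => idTensor s' N (ρ u)) ≥ pGuess p (fun u => idTensor s' N' (ρ u)),
      IsDegradableInto N N' ].TFAE := by
  have hentropy : ∀ (U : Type) [Fintype U] [DecidableEq U] (p : U → ℝ)
      (ρ : U → Matrix (s' × q) (s' × q) ℂ), IsProbDist p → (∀ u, IsDensity (ρ u)) →
      (condMinEntropy (cqState p fun u => idTensor s' N (ρ u)) ≤
          condMinEntropy (cqState p fun u => idTensor s' N' (ρ u)) ↔
        pGuess p (fun u => idTensor s' N (ρ u)) ≥ pGuess p (fun u => idTensor s' N' (ρ u))) := by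
    intro U _ _ p ρ hp hρ
    have h := fun u => hN.isDensity_idTensor (hρ u)
    have h' := fun u => hN'.isDensity_idTensor (hρ u)
    rw [condMinEntropy_cqState_eq hp h, condMinEntropy_cqState_eq hp h', neg_le_neg_iff,
      Real.logb_le_logb one_lt_two (pGuess_pos hp h') (pGuess_pos hp h)]
  tfae_have 1 → 2 := by
    classical
    exact fun h U _ p ρ hp hρ => (hentropy U p ρ hp hρ).1 (h U p ρ hp hρ)
  tfae_have 2 → 1 := fun h U _ _ p ρ hp hρ => (hentropy U p ρ hp hρ).2 (h U p ρ hp hρ)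
  tfae_have 2 → 3 := fun h => isDegradableInto_of_pGuess_le hs' hN hN' h
  tfae_have 3 → 2 := by
    rintro ⟨T, hT, rfl⟩ U _ p ρ hp hρ
    simp only [idTensor_comp]
    exact hT.pGuess_idTensor_le hp fun u => hN.isDensity_idTensor (hρ u)
  tfae_finish
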